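/- Let $\Omega\subset\mathbb{R}$ be a nonempty connected open set (an open interval), and let $F$ be a complex-valued function that is continuous on $\Omega-\Omega=\{x-y: x,y\in\Omega\}$ and positive definite there, i.e. $\sum_{i}\sum_{j}\overline{c_i}\,c_j\,F(x_i-x_j)\ge 0$ for all finite families $c_i\in\mathbb{C}$, $x_i\in\Omega$. Let $\mathscr{H}_F$ be the reproducing kernel Hilbert space of functions on $\Omega$ with kernel $(x,y)\mapsto F(x-y)$, i.e. the completion of the span of the functions $F(\cdot-x)$, $x\in\Omega$, in the inner product (conjugate linear in the first variable) determined by $\langle F(\cdot-x),F(\cdot-y)\rangle_{\mathscr{H}_F}=F(x-y)$. For $\varphi\in C_c^\infty(\Omega)$ (complex-valued) let $F_\varphi\in\mathscr{H}_F$ be given by $F_\varphi(x)=\int_\Omega\varphi(y)F(x-y)\,dy$, $x\in\Omega$. Then the following two conditions are equivalent. (i) There is a continuous positive definite function $\widetilde F:\mathbb{R}\to\mathbb{C}$ with $\widetilde F(x)=F(x)$ for all $x\in\Omega-\Omega$. (ii) There are a complex Hilbert space $\mathscr{K}$, a linear isometry $W:\mathscr{H}_F\to\mathscr{K}$, and a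 strongly continuous one-parameter unitary group $(U_t)_{t\in\mathbb{R}}$ on $\mathscr{K}$ such that, if $A$ denotes its (skew-adjoint) infinitesimal generator, i.e. $Ak=\lim_{t\to0}\tfrac1t(U_tk-k)$ with $\mathrm{dom}(A)$ the set of all $k\in\mathscr{K}$ for which this limit exists, then $$WF_\varphi\in\mathrm{dom}(A)\quad\text{and}\quad AWF_\varphi=WF_{\varphi'}\qquad\text{for all }\varphi\in C_c^\infty(\Omega).$$ -/

import Mathlib

open Filter Topology MeasureTheory TopologicalSpace
open scoped ComplexConjugate ComplexOrder Pointwise Distributions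

universe u

noncomputable section

namespace PDExt

/-- `F` is positive definite on `Ω - Ω`: all finite sums `∑ᵢ ∑ⱼ conj cᵢ * cⱼ * F (xᵢ - xⱼ)` with
`xᵢ ∈ Ω` are real and nonnegative. Only the values of `F` on `Ω - Ω` matter; for `Ω = univ` this is
positive definiteness on `ℝ`. -/
def IsPositiveDefiniteOn (F : ℝ → ℂ) (Ω : Set ℝ) : Prop :=
  ∀ (n : ℕ) (c : Fin n → ℂ) (x : Fin n → ℝ), (∀ i, x i ∈ Ω) →
    0 ≤ ∑ i, ∑ j, conj (c i) * c j * F (x i - x j)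

/-- The kernel `(x, y) ↦ F (x - y)` on `Ω × Ω`; scalars are regarded as operators on `ℂ`. -/
def kernelMatrix (F : ℝ → ℂ) (Ω : Opens ℝ) : Matrix Ω Ω (ℂ →L[ℂ] ℂ) :=
  Matrix.of fun x y => F ((x : ℝ) - y) • ContinuousLinearMap.id ℂ ℂ

variable {F : ℝ → ℂ} {Ω : Opens ℝ}

theorem kernelMatrix_apply (x y : Ω) (z : ℂ) : kernelMatrix F Ω x y z = F ((x : ℝ) - y) * z := by
  simp [kernelMatrix]

theorem IsPositiveDefiniteOn.conj_apply {S : Set ℝ} (hF : IsPositiveDefiniteOn F S) {x y : ℝ}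
    (hx : x ∈ S) (hy : y ∈ S) : conj (F (y - x)) = F (x - y) := by
  have h1 := (Complex.nonneg_iff.1 (hF 1 ![1] ![x] (by simp [hx]))).2
  have h2 := (Complex.nonneg_iff.1 (hF 2 ![1, 1] ![x, y]
    (by intro i; fin_cases i <;> simp [hx, hy]))).2
  have h3 := (Complex.nonneg_iff.1 (hF 2 ![1, Complex.I] ![x, y]
    (by intro i; fin_cases i <;> simp [hx, hy]))).2
  simp [Fin.sum_univ_two] at h1 h2 h3
  apply Complex.ext <;> simp <;> linarith

theorem IsPositiveDefiniteOn.posSemidef (hF : IsPositiveDefiniteOn F Ω) :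
    (kernelMatrix F Ω).PosSemidef := by
  have tfae := (RKHS.posSemidef_tfae (K := kernelMatrix F Ω)).out 0 2
  refine tfae.2 ⟨?_, fun v => ?_⟩
  · ext x y
    refine ext_inner_right ℂ fun w => ?_
    simp only [Matrix.conjTranspose_apply, ContinuousLinearMap.star_eq_adjoint,
      ContinuousLinearMap.adjoint_inner_left, kernelMatrix_apply]
    simp only [RCLike.inner_apply, map_mul, map_one, hF.conj_apply y.2 x.2]
    ring
  · let e := v.support.equivFin
    have h := hF v.support.card (fun i => v (e.symm i)) (fun i => ((e.symm i : Ω) : ℝ))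
      (fun i => (e.symm i : Ω).2)
    have key : (v.sum fun x w => v.sum fun x' w' => inner ℂ (kernelMatrix F Ω x' x w) w') =
        ∑ i, ∑ j, conj (v (e.symm i)) * v (e.symm j) *
          F (((e.symm i : Ω) : ℝ) - ((e.symm j : Ω) : ℝ)) := by
      simp only [Finsupp.sum]
      rw [← Finset.sum_coe_sort v.support, ← e.symm.sum_comp]
      refine Finset.sum_congr rfl fun i _ => ?_
      rw [← Finset.sum_coe_sort v.support, ← e.symm.sum_comp]
      refine Finset.sum_congr rfl fun j _ => ?_
      rw [kernelMatrix_apply, RCLike.inner_apply, map_mul,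
        hF.conj_apply (e.symm i : Ω).2 (e.symm j : Ω).2]
      ring
    rw [key]
    exact (Complex.nonneg_iff.1 h).1

/-- The reproducing kernel Hilbert space `ℋ_F` of the kernel `(x, y) ↦ F (x - y)` on `Ω × Ω`. -/
def HF (hF : IsPositiveDefiniteOn F Ω) : Type :=
  haveI : Fact (kernelMatrix F Ω).PosSemidef := ⟨hF.posSemidef⟩
  RKHS.OfKernel (kernelMatrix F Ω)

instance (hF : IsPositiveDefiniteOn F Ω) : NormedAddCommGroup (HF hF) :=
  haveI : Fact (kernelMatrix F Ω).PosSemidef := ⟨hF.posSemidef⟩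
  inferInstanceAs (NormedAddCommGroup (RKHS.OfKernel (kernelMatrix F Ω)))

instance (hF : IsPositiveDefiniteOn F Ω) : InnerProductSpace ℂ (HF hF) :=
  haveI : Fact (kernelMatrix F Ω).PosSemidef := ⟨hF.posSemidef⟩
  inferInstanceAs (InnerProductSpace ℂ (RKHS.OfKernel (kernelMatrix F Ω)))

instance (hF : IsPositiveDefiniteOn F Ω) : CompleteSpace (HF hF) :=
  haveI : Fact (kernelMatrix F Ω).PosSemidef := ⟨hF.posSemidef⟩
  inferInstanceAs (CompleteSpace (RKHS.OfKernel (kernelMatrix F Ω)))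

instance (hF : IsPositiveDefiniteOn F Ω) : RKHS ℂ (HF hF) Ω ℂ :=
  haveI : Fact (kernelMatrix F Ω).PosSemidef := ⟨hF.posSemidef⟩
  inferInstanceAs (RKHS ℂ (RKHS.OfKernel (kernelMatrix F Ω)) Ω ℂ)

theorem kernel_HF (hF : IsPositiveDefiniteOn F Ω) : RKHS.kernel (HF hF) = kernelMatrix F Ω :=
  haveI : Fact (kernelMatrix F Ω).PosSemidef := ⟨hF.posSemidef⟩
  RKHS.OfKernel.kernel_ofKernel (K := kernelMatrix F Ω)

/-- The kernel function `F (· - y) ∈ ℋ_F`. -/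
def xi (hF : IsPositiveDefiniteOn F Ω) (y : Ω) : HF hF := RKHS.kerFun (HF hF) y (1 : ℂ)

theorem xi_apply (hF : IsPositiveDefiniteOn F Ω) (x y : Ω) : xi hF y x = F ((x : ℝ) - y) := by
  rw [xi, RKHS.kerFun_apply, kernel_HF, kernelMatrix_apply, mul_one]

theorem inner_xi (hF : IsPositiveDefiniteOn F Ω) (x : Ω) (f : HF hF) :
    inner ℂ (xi hF x) f = f x := by
  rw [xi, RKHS.kerFun_inner]; simp

theorem inner_xi_xi (hF : IsPositiveDefiniteOn F Ω) (x y : Ω) :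
    inner ℂ (xi hF x) (xi hF y) = F ((x : ℝ) - y) := by
  rw [inner_xi, xi_apply]

/-- The vector `F_φ = ∫_Ω φ(y) F(· - y) dy` of `ℋ_F`, as a Bochner integral in `ℋ_F`; see
`Fphi_apply` for its values as a function on `Ω`. -/
def Fphi (hF : IsPositiveDefiniteOn F Ω) (φ : ℝ → ℂ) : HF hF :=
  ∫ y : Ω, φ y • xi hF y ∂(volume.comap Subtype.val)

theorem continuous_xi (hF : IsPositiveDefiniteOn F Ω)
    (hc : ContinuousOn F ((Ω : Set ℝ) - (Ω : Set ℝ))) : Continuous (xi hF) := by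
  have hmem (x y : Ω) : (x : ℝ) - y ∈ (Ω : Set ℝ) - (Ω : Set ℝ) := Set.sub_mem_sub x.2 y.2
  have hG : Continuous fun p : Ω × Ω => F ((p.1 : ℝ) - p.2) :=
    hc.comp_continuous (by fun_prop) fun p => hmem p.1 p.2
  have hn (x y : Ω) : ‖xi hF x - xi hF y‖ ^ 2 =
      (F ((x : ℝ) - x) - F ((x : ℝ) - y) - F ((y : ℝ) - x) + F ((y : ℝ) - y)).re := by
    rw [← inner_self_eq_norm_sq (𝕜 := ℂ)]
    simp only [inner_sub_left, inner_sub_right, inner_xi_xi]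
    simp
    ring
  rw [continuous_iff_continuousAt]
  intro y
  rw [ContinuousAt, tendsto_iff_norm_sub_tendsto_zero]
  have h2 : Tendsto (fun x => ‖xi hF x - xi hF y‖ ^ 2) (𝓝 y) (𝓝 0) := by
    simp only [hn]
    have : Continuous fun x : Ω =>
        (F ((x : ℝ) - x) - F ((x : ℝ) - y) - F ((y : ℝ) - x) + F ((y : ℝ) - y)).re :=
      Complex.continuous_re.comp ((((hG.comp (continuous_id.prodMk continuous_id)).sub
        (hG.comp (continuous_id.prodMk continuous_const))).sub
        (hG.comp (continuous_const.prodMk continuous_id))).add continuous_const)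
    have h := this.tendsto y
    simpa using h
  have h3 := h2.sqrt
  simpa using h3

theorem integrable_Fphi (hF : IsPositiveDefiniteOn F Ω)
    (hc : ContinuousOn F ((Ω : Set ℝ) - (Ω : Set ℝ))) {φ : ℝ → ℂ} (hφ : Continuous φ)
    (hφc : HasCompactSupport φ) :
    Integrable (fun y : Ω => φ y • xi hF y) (volume.comap Subtype.val) := by
  have h1 : Integrable (fun y : Ω => φ y) (volume.comap Subtype.val) :=
    (integrableOn_iff_comap_subtypeVal Ω.isOpen.measurableSet).1
      (hφ.integrable_of_hasCompactSupport hφc).integrableOn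
  refine h1.smul_bdd (Real.sqrt ‖F 0‖) (continuous_xi hF hc).aestronglyMeasurable
    (.of_forall fun y => ?_)
  apply Real.le_sqrt_of_sq_le
  rw [← inner_self_eq_norm_sq (𝕜 := ℂ), inner_xi_xi, sub_self]
  exact Complex.re_le_norm _

/-- As a function on `Ω`, `F_φ` is the convolution `x ↦ ∫_Ω φ(y) F(x - y) dy`. -/
theorem Fphi_apply (hF : IsPositiveDefiniteOn F Ω)
    (hc : ContinuousOn F ((Ω : Set ℝ) - (Ω : Set ℝ))) {φ : ℝ → ℂ} (hφ : Continuous φ)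
    (hφc : HasCompactSupport φ) (x : Ω) :
    Fphi hF φ x = ∫ y in (Ω : Set ℝ), φ y * F (x - y) := by
  rw [← inner_xi, Fphi, ← integral_inner (integrable_Fphi hF hc hφ hφc)]
  simp only [inner_smul_right, inner_xi_xi]
  exact integral_subtype_comap Ω.isOpen.measurableSet fun y => φ y * F (x - y)

/-- A strongly continuous one-parameter unitary group on `𝒦`. -/
structure UnitaryGroup (𝒦 : Type*) [NormedAddCommGroup 𝒦] [InnerProductSpace ℂ 𝒦] where
  /-- The unitary operator `U_t`. -/
  U : ℝ → (𝒦 ≃ₗᵢ[ℂ] 𝒦)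
  zero : ∀ k, U 0 k = k
  add : ∀ s t k, U (s + t) k = U s (U t k)
  continuous : ∀ k, Continuous fun t => U t k

namespace UnitaryGroup

variable {𝒦 : Type*} [NormedAddCommGroup 𝒦] [InnerProductSpace ℂ 𝒦]

/-- `(U_t k - k) / t → l` as `t → 0`. -/
def HasGeneratorAt (U : UnitaryGroup 𝒦) (k l : 𝒦) : Prop :=
  Tendsto (fun t : ℝ => ((t⁻¹ : ℝ) : ℂ) • (U.U t k - k)) (𝓝[≠] 0) (𝓝 l)

theorem HasGeneratorAt.add {U : UnitaryGroup 𝒦} {k l k' l' : 𝒦} (h : U.HasGeneratorAt k l)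
    (h' : U.HasGeneratorAt k' l') : U.HasGeneratorAt (k + k') (l + l') := by
  refine (Tendsto.add h h').congr fun t => ?_
  rw [map_add, ← smul_add]
  congr 1
  abel

theorem HasGeneratorAt.smul {U : UnitaryGroup 𝒦} {k l : 𝒦} (h : U.HasGeneratorAt k l) (c : ℂ) :
    U.HasGeneratorAt (c • k) (c • l) := by
  refine (Tendsto.const_smul h c).congr fun t => ?_
  rw [map_smul, ← smul_sub, smul_comm]

theorem HasGeneratorAt.unique {U : UnitaryGroup 𝒦} {k l l' : 𝒦} (h : U.HasGeneratorAt k l)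
    (h' : U.HasGeneratorAt k l') : l = l' :=
  tendsto_nhds_unique h h'

/-- The infinitesimal generator `A` of `U`: its domain is the set of all `k` for which
`(U_t k - k) / t` converges in `𝒦` as `t → 0`, and `A k` is the limit. -/
def generator (U : UnitaryGroup 𝒦) : 𝒦 →ₗ.[ℂ] 𝒦 where
  domain :=
    { carrier := {k | ∃ l, U.HasGeneratorAt k l}
      add_mem' := by
        rintro _ _ ⟨l, h⟩ ⟨l', h'⟩
        exact ⟨_, h.add h'⟩
      zero_mem' := ⟨0, by simp [HasGeneratorAt]⟩
      smul_mem' := by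
        rintro c _ ⟨l, h⟩
        exact ⟨_, h.smul c⟩ }
  toFun :=
    { toFun := fun k => Classical.choose k.2
      map_add' := fun k k' => (Classical.choose_spec (k + k').2).unique
        ((Classical.choose_spec k.2).add (Classical.choose_spec k'.2))
      map_smul' := fun c k => (Classical.choose_spec (c • k).2).unique
        ((Classical.choose_spec k.2).smul c) }

theorem tendsto_generator (U : UnitaryGroup 𝒦) (k : U.generator.domain) :
    Tendsto (fun t : ℝ => ((t⁻¹ : ℝ) : ℂ) • (U.U t k - (k : 𝒦))) (𝓝[≠] 0)
      (𝓝 (U.generator k)) :=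
  Classical.choose_spec k.2

end UnitaryGroup

end PDExt

end

/-! Both conditions say that the kernel functions `xi`, embedded in a larger Hilbert space, lie on a
single orbit of a unitary group.

From an extension `F'`, the reproducing kernel space of `F'` over all of ℝ supplies a total family
`ξ` with Gram kernel `F' (x - y)`. This kernel is translation invariant, so `ξ x ↦ ξ (x - t)`
extends to a unitary group (`exists_translation_group`), and `xi x ↦ ξ x` extends to the isometry
`W`. On `∫ φ y • ξ y` the group shifts `φ`, so the generator differentiates it.

Conversely, put `k = W ∘ xi`. The mollification of `k` at `s` has the generator acting on it as
minus its `s`-derivative, so applying `U_s` gives a function constant in `s`. Letting the mollifier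
shrink, `U_s (k s)` is constant on the interval Ω (`apply_eq_apply_of_hasGeneratorAt`). With `κ` its
value, `k x = U_{-x} κ`, hence `F (x - y) = ⟪κ, U_{x-y} κ⟫`, and the right side is defined,
continuous and positive definite on all of ℝ. -/

noncomputable section

namespace PDExt

/-! ### Isometries determined by Gram kernels -/

section Gram

variable {ι E G : Type*} [NormedAddCommGroup E] [InnerProductSpace ℂ E]
  [NormedAddCommGroup G] [InnerProductSpace ℂ G]

/-- Both squared norms expand into the same quadratic form in the coefficients. This makes the
linear extension of `f i ↦ g i` well defined and isometric. -/
theorem norm_linearCombination_eq {f : ι → E} {g : ι → G}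
    (h : ∀ i j, inner ℂ (g i) (g j) = inner ℂ (f i) (f j)) (a : ι →₀ ℂ) :
    ‖Finsupp.linearCombination ℂ g a‖ = ‖Finsupp.linearCombination ℂ f a‖ := by
  rw [norm_eq_sqrt_re_inner (𝕜 := ℂ), norm_eq_sqrt_re_inner (𝕜 := ℂ)]
  simp only [Finsupp.linearCombination_apply, Finsupp.sum_inner, Finsupp.inner_sum, inner_smul_left,
    inner_smul_right, h]

/-- A map between families of vectors that preserves inner products extends to an isometry. -/
theorem exists_linearIsometry [CompleteSpace G] {f : ι → E} {g : ι → G}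
    (hf : DenseRange (Finsupp.linearCombination ℂ f))
    (h : ∀ i j, inner ℂ (g i) (g j) = inner ℂ (f i) (f j)) :
    ∃ T : E →ₗᵢ[ℂ] G, ∀ i, T (f i) = g i := by
  have hn := norm_linearCombination_eq h
  let T := (Finsupp.linearCombination ℂ g).extendOfNorm (Finsupp.linearCombination ℂ f)
  have hT : ∀ a, T (Finsupp.linearCombination ℂ f a) = Finsupp.linearCombination ℂ g a :=
    LinearMap.extendOfNorm_eq hf ⟨1, fun a => by rw [hn, one_mul]⟩
  refine ⟨⟨T.toLinearMap, fun x => ?_⟩, fun i => ?_⟩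
  · refine hf.induction (P := fun x => ‖T x‖ = ‖x‖) ?_
      (isClosed_eq (by fun_prop) (by fun_prop)) x
    rintro _ ⟨a, rfl⟩
    rw [hT, hn]
  · simpa using hT (Finsupp.single i 1)

/-- An isometry of a complete space has closed range, and here the range contains the dense span of
`g`. -/
theorem exists_linearIsometryEquiv [CompleteSpace E] [CompleteSpace G] {f : ι → E} {g : ι → G}
    (hf : DenseRange (Finsupp.linearCombination ℂ f))
    (hg : DenseRange (Finsupp.linearCombination ℂ g))
    (h : ∀ i j, inner ℂ (g i) (g j) = inner ℂ (f i) (f j)) :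
    ∃ T : E ≃ₗᵢ[ℂ] G, ∀ i, T (f i) = g i := by
  obtain ⟨T, hT⟩ := exists_linearIsometry hf h
  refine ⟨LinearIsometryEquiv.ofSurjective T fun y => ?_, hT⟩
  refine hg.induction (P := fun y => y ∈ Set.range T) ?_ T.isometry.isClosedEmbedding.isClosed_range y
  rintro _ ⟨a, rfl⟩
  refine ⟨Finsupp.linearCombination ℂ f a, ?_⟩
  simp [Finsupp.linearCombination_apply, Finsupp.sum, map_sum, hT]

theorem denseRange_ext {f : ι → E} (hf : DenseRange (Finsupp.linearCombination ℂ f))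
    {S T : E →L[ℂ] G} (h : ∀ i, S (f i) = T (f i)) (x : E) : S x = T x := by
  refine hf.induction (P := fun x => S x = T x) ?_ (isClosed_eq (by fun_prop) (by fun_prop)) x
  rintro _ ⟨a, rfl⟩
  simp [Finsupp.linearCombination_apply, Finsupp.sum, map_sum, h]

end Gram

/-! ### The translation group -/

section Translation

variable {E : Type*} [NormedAddCommGroup E] [InnerProductSpace ℂ E]

/-- Strong continuity of a family of isometries follows from continuity on a total family. -/
theorem continuous_orbit_of_dense {ι X : Type*} [TopologicalSpace X] {f : ι → E}
    (hf : DenseRange (Finsupp.linearCombination ℂ f)) (T : X → E →ₗᵢ[ℂ] E)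
    (hT : ∀ i, Continuous fun t => T t (f i)) (k : E) : Continuous fun t => T t k := by
  refine continuous_of_uniform_approx_of_continuous fun u hu => ?_
  obtain ⟨ε, hε, hεu⟩ := Metric.mem_uniformity_dist.1 hu
  obtain ⟨a, ha⟩ := hf.exists_dist_lt k hε
  refine ⟨fun t => T t (Finsupp.linearCombination ℂ f a), ?_, fun t => hεu ?_⟩
  · simp only [Finsupp.linearCombination_apply, Finsupp.sum, map_sum, map_smul]
    exact continuous_finsetSum _ fun i _ => (hT i).const_smul _
  · rwa [(T t).isometry.dist_eq]

/-- The unitary group `U_t ξ_x = ξ_{x - t}` of a total family `ξ` with translation invariant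
Gram kernel. -/
theorem exists_translation_group [CompleteSpace E] {ξ : ℝ → E} {F : ℝ → ℂ} (hξ : Continuous ξ)
    (hd : DenseRange (Finsupp.linearCombination ℂ ξ))
    (hi : ∀ x y, inner ℂ (ξ x) (ξ y) = F (x - y)) :
    ∃ U : UnitaryGroup E, ∀ t x, U.U t (ξ x) = ξ (x - t) := by
  have hd' (t : ℝ) : DenseRange (Finsupp.linearCombination ℂ fun x => ξ (x - t)) := by
    refine hd.mono ?_
    rintro _ ⟨a, rfl⟩
    -- Shifting the indices by `t` undoes the shift of the family, so both families have the same
    -- span.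
    refine ⟨a.mapDomain (· + t), ?_⟩
    rw [Finsupp.linearCombination_mapDomain]
    congr 2
    ext x
    simp
  choose T hT using fun t : ℝ =>
    exists_linearIsometryEquiv hd (hd' t) (fun x y => by simp [hi])
  refine ⟨⟨T, fun k => ?_, fun s t k => ?_, fun k => ?_⟩, hT⟩
  · exact denseRange_ext hd (S := (T 0 : E →L[ℂ] E)) (T := .id ℂ E) (fun x => by simp [hT]) k
  · refine denseRange_ext hd (S := (T (s + t) : E →L[ℂ] E))
      (T := (T s : E →L[ℂ] E) ∘L (T t : E →L[ℂ] E)) (fun x => ?_) k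
    simp only [ContinuousLinearEquiv.coe_coe, ContinuousLinearMap.comp_apply,
      LinearIsometryEquiv.coe_toContinuousLinearEquiv, hT]
    congr 1
    ring
  · refine continuous_orbit_of_dense hd (fun t => (T t).toLinearIsometry) (fun x => ?_) k
    simp only [LinearIsometryEquiv.coe_toLinearIsometry, hT]
    fun_prop

end Translation

/-! ### Differentiating convolutions -/

section Convolution

variable {E : Type*} [NormedAddCommGroup E] [InnerProductSpace ℂ E]

theorem hasDerivAt_integral_smul_sub {k : ℝ → E} (hk : LocallyIntegrable k) {φ : ℝ → ℂ}
    (hφ : ContDiff ℝ 1 φ) (hφc : HasCompactSupport φ) (s : ℝ) :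
    HasDerivAt (fun s => ∫ y, φ (s - y) • k y) (∫ y, deriv φ (s - y) • k y) s := by
  have := hφc.hasDerivAt_convolution_right (ContinuousLinearMap.lsmul ℝ ℂ (E := E)).flip hk hφ s
  exact this

theorem hasDerivAt_integral_smul_add {k : ℝ → E} (hk : LocallyIntegrable k) {φ : ℝ → ℂ}
    (hφ : ContDiff ℝ 1 φ) (hφc : HasCompactSupport φ) (s : ℝ) :
    HasDerivAt (fun s => ∫ y, φ (y + s) • k y) (∫ y, deriv φ (y + s) • k y) s := by
  -- Reflect both `φ` and the parameter; the two signs cancel.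
  have h := hasDerivAt_integral_smul_sub hk (φ := fun u => φ (-u)) (hφ.comp contDiff_neg)
    (hφc.comp_homeomorph (Homeomorph.neg ℝ)) (-s)
  have h2 := h.scomp s (hasDerivAt_neg s)
  have e : ∀ s y : ℝ, -(-s - y) = y + s := fun s y => by ring
  simpa [Function.comp_def, deriv_comp_neg, e, integral_neg] using h2

end Convolution

/-! ### Calculus of unitary groups and their generators -/

namespace UnitaryGroup

variable {E : Type*} [NormedAddCommGroup E] [InnerProductSpace ℂ E]

/-- Strong continuity upgrades to joint continuity because every `U_a` preserves the norm of `x i -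
k`. -/
theorem tendsto_apply (U : UnitaryGroup E) {ι : Type*} {l : Filter ι} {a : ι → ℝ} {x : ι → E}
    {s : ℝ} {k : E} (ha : Tendsto a l (𝓝 s)) (hx : Tendsto x l (𝓝 k)) :
    Tendsto (fun i => U.U (a i) (x i)) l (𝓝 (U.U s k)) := by
  have h1 : Tendsto (fun i => U.U (a i) (x i - k)) l (𝓝 0) := by
    rw [tendsto_zero_iff_norm_tendsto_zero]
    simpa only [LinearIsometryEquiv.norm_map] using tendsto_iff_norm_sub_tendsto_zero.1 hx
  have h2 := h1.add (((U.continuous k).tendsto s).comp ha)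
  simpa using h2

theorem inner_apply_apply (U : UnitaryGroup E) (s t : ℝ) (k l : E) :
    inner ℂ (U.U (-s) k) (U.U (-t) l) = inner ℂ k (U.U (s - t) l) := by
  rw [← (U.U s).inner_map_map, ← U.add, ← U.add, add_neg_cancel, U.zero, sub_eq_add_neg]

theorem hasGeneratorAt_iff_hasDerivAt (U : UnitaryGroup E) (k l : E) :
    U.HasGeneratorAt k l ↔ HasDerivAt (fun t => U.U t k) l 0 := by
  rw [hasDerivAt_iff_tendsto_slope_zero, HasGeneratorAt]
  simp only [zero_add, U.zero, Complex.coe_smul]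

theorem hasGeneratorAt_iff_generator (U : UnitaryGroup E) (k l : E) :
    U.HasGeneratorAt k l ↔ ∃ h : k ∈ U.generator.domain, U.generator ⟨k, h⟩ = l := by
  refine ⟨fun h => ⟨⟨l, h⟩, HasGeneratorAt.unique (U.tendsto_generator ⟨k, ⟨l, h⟩⟩) h⟩, ?_⟩
  rintro ⟨h, rfl⟩
  exact U.tendsto_generator ⟨k, h⟩

/-- Product rule for `s ↦ U_s (g s)` at a point where `g s` is in the domain of the generator. -/
theorem hasDerivAt_apply (U : UnitaryGroup E) {g : ℝ → E} {g' l : E} {s : ℝ}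
    (hg : HasDerivAt g g' s) (hl : U.HasGeneratorAt (g s) l) :
    HasDerivAt (fun t => U.U t (g t)) (U.U s (l + g')) s := by
  rw [hasDerivAt_iff_tendsto_slope_zero] at hg ⊢
  have ht : Tendsto (fun t : ℝ => s + t) (𝓝[≠] 0) (𝓝 s) := by
    have : Tendsto (fun t : ℝ => s + t) (𝓝 0) (𝓝 (s + 0)) :=
      (continuous_const.add continuous_id).tendsto 0
    simpa using this.mono_left nhdsWithin_le_nhds
  -- The quotient splits as `U_s ((U_t g(s) - g(s)) / t) + U_{s+t} ((g(s+t) - g(s)) / t)`; `h2` and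
  -- `h1` give the two limits.
  have h1 := U.tendsto_apply ht hg
  have h2 := ((U.U s).continuous.tendsto l).comp hl
  rw [map_add]
  refine (h2.add h1).congr fun t => ?_
  simp only [← Complex.coe_smul, Function.comp_apply, map_sub, map_smul, U.add, ← smul_add]
  congr 1
  abel

end UnitaryGroup

/-! ### Mollification and orbits -/

section Mollify

variable {E : Type*} [NormedAddCommGroup E] [InnerProductSpace ℂ E] [CompleteSpace E]

theorem tendsto_integral_normed_smul {k : ℝ → E} (hk : LocallyIntegrable k) {x : ℝ}
    (hx : ContinuousAt k x) {b : ℕ → ContDiffBump (0 : ℝ)}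
    (hb : Tendsto (fun n => (b n).rOut) atTop (𝓝 0)) :
    Tendsto (fun n => ∫ y, (((b n).normed volume (x - y) : ℝ) : ℂ) • k y) atTop (𝓝 (k x)) := by
  have h := ContDiffBump.convolution_tendsto_right (μ := volume) (g := fun _ => k)
    (k := fun _ => x) hb (.of_forall fun _ => hk.aestronglyMeasurable)
    (hx.tendsto.comp tendsto_snd) tendsto_const_nhds
  refine h.congr fun n => ?_
  rw [convolution_def, ← integral_sub_left_eq_self _ volume x]
  simp

/-- If the generator acts on mollifications of `k` over `Ω` as the derivative, then `k` is an
orbit of the group on `Ω`. -/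
theorem apply_eq_apply_of_hasGeneratorAt {Ω : Opens ℝ} (hΩ : IsPreconnected (Ω : Set ℝ))
    (U : UnitaryGroup E) {k : ℝ → E} (hk : LocallyIntegrable k) (hkc : ContinuousOn k Ω)
    (hgen : ∀ φ : 𝓓(Ω, ℂ), U.HasGeneratorAt (∫ y, φ y • k y) (∫ y, deriv φ y • k y))
    {x x' : ℝ} (hx : x ∈ Ω) (hx' : x' ∈ Ω) (hxx : x ≤ x') : U.U x' (k x') = U.U x (k x) := by
  have hI : Set.Icc x x' ⊆ Ω := hΩ.ordConnected.out hx hx'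
  -- Bumps of radius at most `r` centred anywhere in `[x, x']` are then test functions on Ω.
  obtain ⟨r, hr, hrΩ⟩ := isCompact_Icc.exists_cthickening_subset_open Ω.isOpen hI
  let b (n : ℕ) : ContDiffBump (0 : ℝ) :=
    ⟨r / (n + 1) / 2, r / (n + 1), by positivity, half_lt_self (by positivity)⟩
  have hb : Tendsto (fun n => (b n).rOut) atTop (𝓝 0) := by
    simpa [b, div_eq_mul_inv] using (tendsto_one_div_add_atTop_nhds_zero_nat (𝕜 := ℝ)).const_mul r
  have hbr (n : ℕ) : (b n).rOut ≤ r := div_le_self hr.le (by simp)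
  let φ (n : ℕ) (u : ℝ) : ℂ := ((b n).normed volume u : ℝ)
  have hφ (n : ℕ) : ContDiff ℝ (⊤ : ℕ∞) (φ n) :=
    Complex.ofRealCLM.contDiff.comp (b n).contDiff_normed
  have hφc (n : ℕ) : HasCompactSupport (φ n) :=
    (b n).hasCompactSupport_normed.comp_left (g := Complex.ofReal) Complex.ofReal_zero
  have hconst (n : ℕ) : U.U x' (∫ y, φ n (x' - y) • k y) = U.U x (∫ y, φ n (x - y) • k y) := by
    have hd (s : ℝ) (hs : s ∈ Set.Icc x x') :
        HasDerivAt (fun t => U.U t (∫ y, φ n (t - y) • k y)) 0 s := by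
      have h1 := hasDerivAt_integral_smul_sub hk ((hφ n).of_le (by simp)) (hφc n) s
      let ψ : 𝓓(Ω, ℂ) :=
        { toFun := fun y => φ n (s - y)
          contDiff' := (hφ n).comp (contDiff_const.sub contDiff_id)
          hasCompactSupport' := (hφc n).comp_homeomorph (Homeomorph.subLeft s)
          tsupport_subset' := by
            refine (closure_minimal (fun y hy => ?_) Metric.isClosed_closedBall).trans
              ((Metric.closedBall_subset_cthickening hs r).trans hrΩ)
            have hy' : s - y ∈ Function.support ((b n).normed volume) := by
              simpa [φ] using hy
            rw [ContDiffBump.support_normed_eq, mem_ball_zero_iff] at hy'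
            rw [Metric.mem_closedBall, dist_comm, dist_eq_norm]
            exact hy'.le.trans (hbr n) }
      -- The minus sign comes from differentiating in `y` rather than in `s`; it makes this term
      -- cancel `h1` in the product rule.
      have h2 : U.HasGeneratorAt (∫ y, φ n (s - y) • k y) (-∫ y, deriv (φ n) (s - y) • k y) := by
        have := hgen ψ
        have e : deriv ψ = fun y => -deriv (φ n) (s - y) := by
          ext y
          exact deriv_comp_const_sub (f := φ n) s y
        simp only [e, neg_smul, integral_neg] at this
        exact this
      simpa using U.hasDerivAt_apply h1 h2
    exact constant_of_has_deriv_right_zero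
      (fun s hs => (hd s hs).continuousAt.continuousWithinAt)
      (fun s hs => (hd s (Set.Ico_subset_Icc_self hs)).hasDerivWithinAt) x'
      (Set.right_mem_Icc.2 hxx)
  have hlim {z : ℝ} (hz : z ∈ Ω) :
      Tendsto (fun n => U.U z (∫ y, φ n (z - y) • k y)) atTop (𝓝 (U.U z (k z))) :=
    ((U.U z).continuous.tendsto _).comp
      (tendsto_integral_normed_smul hk (hkc.continuousAt (Ω.isOpen.mem_nhds hz)) hb)
  exact tendsto_nhds_unique (hlim hx') ((hlim hx).congr fun n => (hconst n).symm)

end Mollify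

/-! ### Kernel functions as a vector field on the line -/

section Kernel

variable {F : ℝ → ℂ} {Ω : Opens ℝ}

theorem norm_xi_le (hF : IsPositiveDefiniteOn F Ω) (y : Ω) : ‖xi hF y‖ ≤ √‖F 0‖ := by
  apply Real.le_sqrt_of_sq_le
  rw [← inner_self_eq_norm_sq (𝕜 := ℂ), inner_xi_xi, sub_self]
  exact Complex.re_le_norm _

/-- By the reproducing property, a vector orthogonal to all kernel functions vanishes at every
point. -/
theorem denseRange_linearCombination_xi (hF : IsPositiveDefiniteOn F Ω) :
    DenseRange (Finsupp.linearCombination ℂ (xi hF)) := by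
  have h : (Submodule.span ℂ (Set.range (xi hF))).topologicalClosure = ⊤ := by
    rw [Submodule.topologicalClosure_eq_top_iff, Submodule.eq_bot_iff]
    refine fun f hf => RKHS.ext (𝕜 := ℂ) fun x => ?_
    rw [← inner_xi, RKHS.coe_zero (𝕜 := ℂ), Pi.zero_apply]
    exact Submodule.inner_right_of_mem_orthogonal 
      (Submodule.subset_span (Set.mem_range_self x)) hf
  rw [← Submodule.dense_iff_topologicalClosure_eq_top, ← Finsupp.range_linearCombination] at h
  exact h

variable {E : Type*} [NormedAddCommGroup E] [InnerProductSpace ℂ E]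

/-- The image under `W` of the kernel functions, extended by zero outside `Ω`. -/
def kernelField (hF : IsPositiveDefiniteOn F Ω) (W : HF hF →ₗᵢ[ℂ] E) (y : ℝ) : E :=
  open Classical in if h : y ∈ Ω then W (xi hF ⟨y, h⟩) else 0

theorem kernelField_coe (hF : IsPositiveDefiniteOn F Ω) (W : HF hF →ₗᵢ[ℂ] E) (y : Ω) :
    kernelField hF W y = W (xi hF y) := by
  simp [kernelField]

theorem kernelField_of_notMem (hF : IsPositiveDefiniteOn F Ω) (W : HF hF →ₗᵢ[ℂ] E) {y : ℝ}
    (hy : y ∉ Ω) : kernelField hF W y = 0 := by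
  simp [kernelField, hy]

theorem inner_kernelField (hF : IsPositiveDefiniteOn F Ω) (W : HF hF →ₗᵢ[ℂ] E) {x y : ℝ}
    (hx : x ∈ Ω) (hy : y ∈ Ω) :
    inner ℂ (kernelField hF W x) (kernelField hF W y) = F (x - y) := by
  simp [kernelField, hx, hy, inner_xi_xi]

theorem continuousOn_kernelField (hF : IsPositiveDefiniteOn F Ω)
    (hc : ContinuousOn F ((Ω : Set ℝ) - (Ω : Set ℝ))) (W : HF hF →ₗᵢ[ℂ] E) :
    ContinuousOn (kernelField hF W) Ω := by
  rw [continuousOn_iff_continuous_domRestrict]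
  refine (W.continuous.comp (continuous_xi hF hc)).congr fun y => ?_
  exact (kernelField_coe hF W y).symm

/-- The extension by zero may jump at the boundary of Ω, but it is bounded and measurable, which is
enough for convolution with test functions. -/
theorem locallyIntegrable_kernelField (hF : IsPositiveDefiniteOn F Ω)
    (hc : ContinuousOn F ((Ω : Set ℝ) - (Ω : Set ℝ))) (W : HF hF →ₗᵢ[ℂ] E) :
    LocallyIntegrable (kernelField hF W) := by
  refine (memLp_top_of_bound ?_ √‖F 0‖ (.of_forall fun y => ?_)).locallyIntegrable le_top
  · have h : (Ω : Set ℝ).indicator (kernelField hF W) = kernelField hF W :=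
      Set.indicator_eq_self.2 fun y hy => by_contra fun h => hy (kernelField_of_notMem hF W h)
    rw [← h, aestronglyMeasurable_indicator_iff Ω.isOpen.measurableSet]
    exact (continuousOn_kernelField hF hc W).aestronglyMeasurable Ω.isOpen.measurableSet
  · by_cases hy : y ∈ Ω
    · simpa [kernelField, hy] using norm_xi_le hF ⟨y, hy⟩
    · simp [kernelField, hy]

theorem apply_Fphi [CompleteSpace E] (hF : IsPositiveDefiniteOn F Ω)
    (hc : ContinuousOn F ((Ω : Set ℝ) - (Ω : Set ℝ))) (W : HF hF →ₗᵢ[ℂ] E) {φ : ℝ → ℂ}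
    (hφ : Continuous φ) (hφc : HasCompactSupport φ) :
    W (Fphi hF φ) = ∫ y, φ y • kernelField hF W y := by
  have h := W.toContinuousLinearMap.integral_comp_comm (integrable_Fphi hF hc hφ hφc)
  simp only [LinearIsometry.coe_toContinuousLinearMap, map_smul] at h
  rw [Fphi, ← h]
  simp only [← kernelField_coe]
  refine (integral_subtype_comap Ω.isOpen.measurableSet fun y => φ y • kernelField hF W y).trans ?_
  exact setIntegral_eq_integral_of_forall_compl_eq_zero fun y hy => by
    rw [kernelField_of_notMem hF W hy, smul_zero]

end Kernel

/-- The double sum is the squared norm of `∑ i, c i • U_{-x i} k`. -/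
theorem isPositiveDefiniteOn_inner_apply {E : Type*} [NormedAddCommGroup E]
    [InnerProductSpace ℂ E] (U : UnitaryGroup E) (k : E) :
    IsPositiveDefiniteOn (fun t => inner ℂ k (U.U t k)) Set.univ := by
  intro n c x _
  have h : ∑ i, ∑ j, conj (c i) * c j * inner ℂ k (U.U (x i - x j) k) =
      inner ℂ (∑ i, c i • U.U (-x i) k) (∑ i, c i • U.U (-x i) k) := by
    rw [sum_inner]
    simp only [inner_sum, inner_smul_left, inner_smul_right, U.inner_apply_apply]
    exact Finset.sum_congr rfl fun i _ => Finset.sum_congr rfl fun j _ => by ring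
  rw [h, inner_self_eq_norm_sq_to_K]
  exact pow_nonneg (RCLike.ofReal_nonneg.2 (norm_nonneg (∑ i, c i • U.U (-x i) k))) 2

/-! ### Models in an arbitrary universe -/

section ULift

variable {E : Type*} [NormedAddCommGroup E] [InnerProductSpace ℂ E]

/-- `HF` lives in `Type`, whereas the space `𝒦` is sought in `Type u`. -/
instance : InnerProductSpace ℂ (ULift.{u} E) where
  inner x y := inner ℂ x.down y.down
  norm_sq_eq_re_inner x := norm_sq_eq_re_inner x.down
  conj_inner_symm x y := inner_conj_symm x.down y.down
  add_left x y z := inner_add_left x.down y.down z.down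
  smul_left x y r := inner_smul_left x.down y.down r

end ULift

/-- A continuous positive definite function on `ℝ` is the Gram kernel of a total continuous
family in a Hilbert space of any given universe. -/
theorem IsPositiveDefiniteOn.exists_gram {F : ℝ → ℂ} (hF : IsPositiveDefiniteOn F Set.univ)
    (hc : Continuous F) :
    ∃ (𝒦 : Type u) (_ : NormedAddCommGroup 𝒦) (_ : InnerProductSpace ℂ 𝒦) (_ : CompleteSpace 𝒦)
      (ξ : ℝ → 𝒦), Continuous ξ ∧ DenseRange (Finsupp.linearCombination ℂ ξ) ∧
        ∀ x y, inner ℂ (ξ x) (ξ y) = F (x - y) := by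
  have hF' : IsPositiveDefiniteOn F ((⊤ : Opens ℝ) : Set ℝ) := hF
  let ξ (x : ℝ) : ULift.{u} (HF hF') := ULift.up (xi hF' ⟨x, trivial⟩)
  refine ⟨ULift.{u} (HF hF'), inferInstance, inferInstance, inferInstance, ξ, ?_, ?_, fun x y =>
    inner_xi_xi hF' _ _⟩
  · exact continuous_uliftUp.comp
      ((continuous_xi hF' hc.continuousOn).comp (continuous_id.subtype_mk _))
  · have h := (ULift.up_surjective.denseRange (α := HF hF')).comp
      (denseRange_linearCombination_xi hF') continuous_uliftUp
    refine h.mono ?_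
    rintro _ ⟨a, rfl⟩
    refine ⟨a.mapDomain Subtype.val, ?_⟩
    rw [Finsupp.linearCombination_mapDomain]
    exact (Finsupp.apply_linearCombination ℂ (ULift.moduleEquiv (R := ℂ)).symm.toLinearMap
      (xi hF') a).symm

/-! ### The two implications -/

theorem exists_unitaryGroup_of_extension {Ω : Opens ℝ} {F : ℝ → ℂ}
    (hc : ContinuousOn F ((Ω : Set ℝ) - (Ω : Set ℝ))) (hF : IsPositiveDefiniteOn F (Ω : Set ℝ))
    {F' : ℝ → ℂ} (hc' : Continuous F') (hF' : IsPositiveDefiniteOn F' Set.univ)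
    (hFF' : ∀ x ∈ (Ω : Set ℝ) - (Ω : Set ℝ), F' x = F x) :
    ∃ (𝒦 : Type u) (_ : NormedAddCommGroup 𝒦) (_ : InnerProductSpace ℂ 𝒦) (_ : CompleteSpace 𝒦)
      (W : HF hF →ₗᵢ[ℂ] 𝒦) (U : UnitaryGroup 𝒦),
      ∀ φ : 𝓓(Ω, ℂ), U.HasGeneratorAt (W (Fphi hF φ)) (W (Fphi hF (deriv φ))) := by
  obtain ⟨𝒦, _, _, _, ξ, hξ, hd, hi⟩ := hF'.exists_gram hc'
  obtain ⟨U, hU⟩ := exists_translation_group hξ hd hi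
  obtain ⟨W, hW⟩ := exists_linearIsometry (denseRange_linearCombination_xi hF)
    (g := fun x : Ω => ξ x)
    (fun x y => by rw [hi, inner_xi_xi, hFF' _ (Set.sub_mem_sub x.2 y.2)])
  refine ⟨𝒦, _, _, inferInstance, W, U, fun φ => ?_⟩
  have hWφ {ψ : ℝ → ℂ} (hψ : Continuous ψ) (hψc : HasCompactSupport ψ) (hψΩ : tsupport ψ ⊆ Ω) :
      W (Fphi hF ψ) = ∫ y, ψ y • ξ y := by
    rw [apply_Fphi hF hc W hψ hψc]
    congr 1
    ext y
    by_cases hy : y ∈ Ω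
    · rw [kernelField_coe hF W ⟨y, hy⟩, hW]
    · rw [image_eq_zero_of_notMem_tsupport fun h => hy (hψΩ h), zero_smul, zero_smul]
  have hφ1 : ContDiff ℝ 1 φ := φ.contDiff.of_le (by simp)
  rw [U.hasGeneratorAt_iff_hasDerivAt, hWφ φ.continuous φ.hasCompactSupport φ.tsupport_subset,
    hWφ (hφ1.continuous_deriv le_rfl) φ.hasCompactSupport.deriv
      (tsupport_deriv_subset.trans φ.tsupport_subset)]
  have h := hasDerivAt_integral_smul_add hξ.locallyIntegrable hφ1 φ.hasCompactSupport 0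
  simp only [add_zero] at h
  refine h.congr_of_eventuallyEq (.of_forall fun t => ?_)
  have hint : Integrable fun y => φ y • ξ y :=
    (φ.continuous.smul hξ).integrable_of_hasCompactSupport φ.hasCompactSupport.smul_right
  have h1 := (U.U t).toContinuousLinearEquiv.toContinuousLinearMap.integral_comp_comm hint
  simp only [ContinuousLinearEquiv.coe_coe, LinearIsometryEquiv.coe_toContinuousLinearEquiv,
    map_smul, hU] at h1
  refine h1.symm.trans ?_
  -- Substituting `y + t` for `y` moves the translation from `ξ` onto `φ`.
  rw [← integral_add_right_eq_self _ t]
  simp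

theorem exists_extension_of_unitaryGroup {Ω : Opens ℝ} (hΩ : IsConnected (Ω : Set ℝ)) {F : ℝ → ℂ}
    (hc : ContinuousOn F ((Ω : Set ℝ) - (Ω : Set ℝ))) (hF : IsPositiveDefiniteOn F (Ω : Set ℝ))
    {𝒦 : Type*} [NormedAddCommGroup 𝒦] [InnerProductSpace ℂ 𝒦] [CompleteSpace 𝒦]
    (W : HF hF →ₗᵢ[ℂ] 𝒦) (U : UnitaryGroup 𝒦)
    (hU : ∀ φ : 𝓓(Ω, ℂ), U.HasGeneratorAt (W (Fphi hF φ)) (W (Fphi hF (deriv φ)))) :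
    ∃ F' : ℝ → ℂ, Continuous F' ∧ IsPositiveDefiniteOn F' Set.univ ∧
      ∀ x ∈ (Ω : Set ℝ) - (Ω : Set ℝ), F' x = F x := by
  obtain ⟨x₀, hx₀⟩ := hΩ.nonempty
  let k := kernelField hF W
  have hgen (φ : 𝓓(Ω, ℂ)) : U.HasGeneratorAt (∫ y, φ y • k y) (∫ y, deriv φ y • k y) := by
    have hφ1 : ContDiff ℝ 1 φ := φ.contDiff.of_le (by simp)
    rw [← apply_Fphi hF hc W φ.continuous φ.hasCompactSupport,
      ← apply_Fphi hF hc W (hφ1.continuous_deriv le_rfl) φ.hasCompactSupport.deriv]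
    exact hU φ
  have horbit {x y : ℝ} (hx : x ∈ Ω) (hy : y ∈ Ω) (hxy : x ≤ y) : U.U y (k y) = U.U x (k x) :=
    apply_eq_apply_of_hasGeneratorAt hΩ.isPreconnected U (locallyIntegrable_kernelField hF hc W)
      (continuousOn_kernelField hF hc W) hgen hx hy hxy
  -- The common value of `U_x (k x)` over Ω; the base point `x₀` is arbitrary.
  let κ := U.U x₀ (k x₀)
  have hk {x : ℝ} (hx : x ∈ Ω) : k x = U.U (-x) κ := by
    have h : U.U x (k x) = κ := (le_total x x₀).elim
      (fun h => (horbit hx hx₀ h).symm) (fun h => horbit hx₀ hx h)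
    rw [← h, ← U.add, neg_add_cancel, U.zero]
  refine ⟨fun t => inner ℂ κ (U.U t κ), continuous_const.inner (U.continuous κ),
    isPositiveDefiniteOn_inner_apply U κ, ?_⟩
  rintro _ ⟨x, hx, y, hy, rfl⟩
  change inner ℂ κ (U.U (x - y) κ) = F (x - y)
  rw [← U.inner_apply_apply, ← hk hx, ← hk hy, inner_kernelField hF W hx hy]

end PDExt

end

theorem mainTheorem1 (Ω : Opens ℝ) (hΩ : IsConnected (Ω : Set ℝ)) (F : ℝ → ℂ)
    (hc : ContinuousOn F ((Ω : Set ℝ) - (Ω : Set ℝ)))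
    (hF : PDExt.IsPositiveDefiniteOn F (Ω : Set ℝ)) :
    (∃ F' : ℝ → ℂ, Continuous F' ∧ PDExt.IsPositiveDefiniteOn F' Set.univ ∧
      ∀ x ∈ (Ω : Set ℝ) - (Ω : Set ℝ), F' x = F x) ↔
    ∃ (𝒦 : Type u) (_ : NormedAddCommGroup 𝒦) (_ : InnerProductSpace ℂ 𝒦) (_ : CompleteSpace 𝒦)
      (W : PDExt.HF hF →ₗᵢ[ℂ] 𝒦) (U : PDExt.UnitaryGroup 𝒦),
      ∀ φ : 𝓓(Ω, ℂ), ∃ h : W (PDExt.Fphi hF φ) ∈ U.generator.domain,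
        U.generator ⟨W (PDExt.Fphi hF φ), h⟩ = W (PDExt.Fphi hF (deriv φ)) := by
  simp only [← PDExt.UnitaryGroup.hasGeneratorAt_iff_generator]
  constructor
  · rintro ⟨F', hc', hF', hFF'⟩
    exact PDExt.exists_unitaryGroup_of_extension hc hF hc' hF' hFF'
  · rintro ⟨𝒦, _, _, _, W, U, hU⟩
    exact PDExt.exists_extension_of_unitaryGroup hΩ hc hF W U hU
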